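/- Let $\mathcal H$ be a finite-dimensional complex Hilbert space, $T>0$, $\omega = 2\pi/T$, $M\in\mathbb N=\{0,1,2,\dots\}$, $\alpha\in\mathbb R$, and let $$H(t)=\sum_{m=-M}^{M} H_m e^{-im\omega t}$$ be a time-periodic Hamiltonian on $\mathcal H$, i.e. the $H_m$ are operators on $\mathcal H$ such that $H(t)$ is self-adjoint for every $t\in\mathbb R$, with $\|H_m\|\le\alpha$ (operator norm) for all $|m|\le M$. Let $\epsilon\in[-\omega/2,\omega/2)$. A Floquet eigenstate with quasienergy $\epsilon$ is a $T$-periodic function $\phi:\mathbb R\to\mathcal H$ with $\|\phi(t)\|=1$ for all $t$ such that $\psi(t)=e^{-i\epsilon t}\phi(t)$ solves $i\,\frac{d}{dt}\psi(t)=H(t)\psi(t)$; its Fourier components are $\phi^l=\frac1T\int_0^T e^{il\omega t}\phi(t)\,dt$, $l\in\mathbb Z$. Equivalently, a Floquet eigenstate is given in the Sambe space $\ell^2(\mathbb Z)\otimes\mathcal H$ by a unit vector $\Phi=(\phi^l)_{l\in\mathbb Z}$ satisfying $H_{\mathrm F}\Phi=\epsilon\Phi$, i.e. $\sum_{m=-M}^{M}H_m\phi^{l-m}-l\omega\,\phi^l=\epsilon\,\phi^l$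 for all $l\in\mathbb Z$. Then, for every Floquet eigenstate with quasienergy $\epsilon$, in either of the two descriptions, every Fourier component satisfies $$\|\phi^l\|\le\exp\left(-\frac{|l|-1/2}{2M+1}+\frac{\sinh 1}{2\pi}\,\alpha T\right)\qquad(l\in\mathbb Z).$$ -/

import Mathlib

/-! Time-periodic Hamiltonians on a finite-dimensional complex Hilbert space `E`, their Floquet
eigenstates and the Sambe (frequency) space. -/

namespace Floquet

noncomputable section

/-- The angular frequency `ω = 2π / T` belonging to the period `T`. -/
def freq (T : ℝ) : ℝ := 2 * Real.pi / T

/-- The Brillouin zone `[-ω/2, ω/2)`. -/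
def brillouinZone (T : ℝ) : Set ℝ := Set.Ico (-(freq T) / 2) (freq T / 2)

/-- The time-periodic operator `H(t) = ∑_{m=-M}^{M} H_m e^{-imωt}`. Only the values `H m` with
`|m| ≤ M` are used. -/
def hamiltonian {E : Type*} [NormedAddCommGroup E] [InnerProductSpace ℂ E]
    (T : ℝ) (M : ℕ) (H : ℤ → E →L[ℂ] E) (t : ℝ) : E →L[ℂ] E :=
  ∑ m ∈ Finset.Icc (-(M : ℤ)) (M : ℤ),
    Complex.exp (-(Complex.I * (m : ℂ) * (freq T : ℂ) * (t : ℂ))) • H m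

/-- `H(t) = ∑_{m=-M}^{M} H_m e^{-imωt}` is a Hamiltonian (self-adjoint at every time), and its
Fourier components satisfy `‖H_m‖ ≤ α` in operator norm. -/
structure IsBoundedHamiltonian {E : Type*} [NormedAddCommGroup E] [InnerProductSpace ℂ E]
    (T : ℝ) (M : ℕ) (α : ℝ) (H : ℤ → E →L[ℂ] E) : Prop where
  symmetric : ∀ t : ℝ, (hamiltonian T M H t : E →ₗ[ℂ] E).IsSymmetric
  norm_le : ∀ m ∈ Finset.Icc (-(M : ℤ)) (M : ℤ), ‖H m‖ ≤ α

/-- `φ` is a (normalized) Floquet eigenstate with quasienergy `ε`: it is `T`-periodic, and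
`ψ(t) = e^{-iεt} φ(t)` solves the Schrödinger equation `i ψ'(t) = H(t) ψ(t)`. -/
structure IsFloquetEigenstate {E : Type*} [NormedAddCommGroup E] [InnerProductSpace ℂ E]
    (T : ℝ) (M : ℕ) (H : ℤ → E →L[ℂ] E) (ε : ℝ) (φ : ℝ → E) : Prop where
  periodic : Function.Periodic φ T
  norm_eq_one : ∀ t : ℝ, ‖φ t‖ = 1
  schrodinger : ∀ t : ℝ,
    HasDerivAt (fun s : ℝ => Complex.exp (-(Complex.I * (ε : ℂ) * (s : ℂ))) • φ s)
      ((-Complex.I) • hamiltonian T M H t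
        (Complex.exp (-(Complex.I * (ε : ℂ) * (t : ℂ))) • φ t)) t

/-- The Fourier component `φ^l = (1/T) ∫_0^T e^{ilωt} φ(t) dt`, so that
`φ(t) = ∑_l e^{-ilωt} φ^l`. -/
def fourierComponent {E : Type*} [NormedAddCommGroup E] [InnerProductSpace ℂ E]
    (T : ℝ) (φ : ℝ → E) (l : ℤ) : E :=
  (1 / (T : ℂ)) • ∫ t in (0 : ℝ)..T,
    Complex.exp (Complex.I * (l : ℂ) * (freq T : ℂ) * (t : ℂ)) • φ t

/-- The Sambe space `ℓ²(ℤ) ⊗ E`, i.e. the square-summable families `(Φ^l)_{l ∈ ℤ}` in `E`. -/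
abbrev SambeSpace (E : Type*) [NormedAddCommGroup E] [InnerProductSpace ℂ E] : Type _ :=
  lp (fun _ : ℤ => E) 2

/-- The action of the Floquet Hamiltonian
`H_F = ∑_{l,m} |l+m⟩⟨l| ⊗ H_m - ∑_l l ω |l⟩⟨l| ⊗ 1` on families `(Φ^l)_{l ∈ ℤ}`. -/
def floquetHamiltonian {E : Type*} [NormedAddCommGroup E] [InnerProductSpace ℂ E]
    (T : ℝ) (M : ℕ) (H : ℤ → E →L[ℂ] E) (Φ : ℤ → E) (l : ℤ) : E :=
  (∑ m ∈ Finset.Icc (-(M : ℤ)) (M : ℤ), H m (Φ (l - m))) - ((l : ℂ) * (freq T : ℂ)) • Φ l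

/-- `Φ` is a (normalized) eigenvector `H_F Φ = ε Φ` in the Sambe space. Since `ε Φ` is
square-summable, such a `Φ` automatically lies in the domain
`{Φ | ∑_l ‖l ω Φ^l‖² < ∞}` of the unbounded operator `H_F`. -/
structure IsSambeEigenstate {E : Type*} [NormedAddCommGroup E] [InnerProductSpace ℂ E]
    (T : ℝ) (M : ℕ) (H : ℤ → E →L[ℂ] E) (ε : ℝ) (Φ : SambeSpace E) : Prop where
  norm_eq_one : ‖Φ‖ = 1
  eigen : ∀ l : ℤ, floquetHamiltonian T M H (fun k => Φ k) l = (ε : ℂ) • Φ l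

end

end Floquet

/-!
Pair the eigenvalue equation `∑ m, H_m φ^{l-m} - l ω φ^l = ε φ^l` with `φ^l`, take real parts, and
weight the result by `w_l ^ 2`, where `w_l = exp (κ min (l, N))`. The truncation at `N` keeps the
weighted family `v_l = w_l ‖φ^l‖` square-summable, and costs little: `w_l ≤ max 1 e^{κm} w_{l-m}`.
By AM-GM and shift invariance the hopping terms sum to at most `α S ∑ v_l ^ 2` with
`S = ∑_{|m| ≤ M} max 1 e^{κm}`, so the mean of `min (l, N)` with respect to the weights `v_l ^ 2`
is at most `(α S - ε) / ω`. The tangent inequality `e^x - e^a ≤ e^x (x - a)` turns this bound on a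
mean into `∑ v_l ^ 2 ≤ exp (2κ (α S - ε) / ω)`; reading off the term `l = N` gives
`‖φ^N‖ ≤ exp (-κ N + κ (α S - ε) / ω)` (`norm_le_exp_of_eigen`).

For `κ = 1 / (2M + 1)` all exponents `κm` are at most `1/2`, and `κ S ≤ 7/6 ≤ sinh 1`
(`weight_sum_le_sinh_one`); together with `|ε| ≤ ω / 2` this is the stated bound for `l ≥ 0`.
Negative `l` follow by the reflection `l ↦ -l`, which replaces `H_m` by `-H_{-m}` and `ε` by `-ε`
(`norm_le_of_floquetHamiltonian_eq`).

The argument needs only `∑ ‖φ^l‖ ^ 2 ≤ 1`. For a Floquet eigenstate in the time domain this is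
Bessel's inequality (`sum_norm_sq_fourierComponent_le_one`), and the eigenvalue equation for its
Fourier components is an integration by parts
(`IsFloquetEigenstate.floquetHamiltonian_fourierComponent`).
-/

namespace Floquet

/-! ### Exponential decay from the eigenvalue equation -/

lemma re_inner_le_of_norm_le {E : Type*} [NormedAddCommGroup E] [InnerProductSpace ℂ E]
    {α : ℝ} {B : E →L[ℂ] E} (hB : ‖B‖ ≤ α) (x y : E) :
    (inner ℂ x (B y)).re ≤ α * (‖x‖ * ‖y‖) := by
  calc (inner ℂ x (B y)).re ≤ ‖x‖ * ‖B y‖ := re_inner_le_norm (𝕜 := ℂ) x (B y)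
    _ ≤ ‖x‖ * (α * ‖y‖) := by gcongr; exact B.le_of_opNorm_le hB y
    _ = _ := by ring

/-- The real part of the eigenvalue equation at `l`, paired with `u l`. -/
lemma mul_norm_sq_le {E : Type*} [NormedAddCommGroup E] [InnerProductSpace ℂ E]
    {ω ε α : ℝ} {s : Finset ℤ} {A : ℤ → E →L[ℂ] E}
    (hA : ∀ m ∈ s, ‖A m‖ ≤ α) {u : ℤ → E} {l : ℤ}
    (heq : (∑ m ∈ s, A m (u (l - m))) - ((l : ℂ) * (ω : ℂ)) • u l = (ε : ℂ) • u l) :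
    ω * l * ‖u l‖ ^ 2 ≤ ∑ m ∈ s, α * (‖u l‖ * ‖u (l - m)‖) - ε * ‖u l‖ ^ 2 := by
  have h := congrArg (fun x => (inner ℂ (u l) x).re) heq
  simp only [inner_sub_right, inner_sum, inner_smul_right, inner_self_eq_norm_sq_to_K,
    Complex.sub_re, Complex.re_sum] at h
  have e1 : ((l : ℂ) * (ω : ℂ) * ((‖u l‖ : ℂ)) ^ 2).re = ω * l * ‖u l‖ ^ 2 := by
    rw [show (l : ℂ) * (ω : ℂ) * ((‖u l‖ : ℂ)) ^ 2 = ((ω * l * ‖u l‖ ^ 2 : ℝ) : ℂ) by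
      push_cast; ring, Complex.ofReal_re]
  have e2 : ((ε : ℂ) * ((‖u l‖ : ℂ)) ^ 2).re = ε * ‖u l‖ ^ 2 := by
    rw [← Complex.ofReal_pow, ← Complex.ofReal_mul, Complex.ofReal_re]
  erw [e1, e2] at h
  have := Finset.sum_le_sum fun m hm => re_inner_le_of_norm_le (hA m hm) (u l) (u (l - m))
  linarith

/-- The truncated weight `exp (κ min (l, N))` grows by at most the factor `max 1 (exp (κ m))` under a
shift by `m`; shifts in the negative direction give `1` because of the truncation. -/
lemma exp_min_le (κ : ℝ) (hκ : 0 ≤ κ) (N l m : ℤ) :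
    Real.exp (κ * (min l N : ℤ)) ≤
      max 1 (Real.exp (κ * m)) * Real.exp (κ * (min (l - m) N : ℤ)) := by
  rcases le_total 0 m with hm | hm
  · calc Real.exp (κ * (min l N : ℤ))
        ≤ Real.exp (κ * m) * Real.exp (κ * (min (l - m) N : ℤ)) := by
          rw [← Real.exp_add, ← mul_add, ← Int.cast_add]
          gcongr
          omega
      _ ≤ _ := by gcongr; exact le_max_right _ _
  · calc Real.exp (κ * (min l N : ℤ))
        ≤ 1 * Real.exp (κ * (min (l - m) N : ℤ)) := by
          rw [one_mul]
          gcongr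
          omega
      _ ≤ _ := by gcongr; exact le_max_left _ _

/-- The shifts `l ↦ v (l - m) ^ 2` have the same sum as `v ^ 2`, so the right-hand side of the
hypothesis sums to zero. -/
lemma tsum_sq_le_of_convolution_le {s : Finset ℤ} {c : ℤ → ℝ} {v p : ℤ → ℝ} {d B : ℝ}
    (hv : Summable fun l => v l ^ 2) (hp : Summable p) (hp1 : ∑' l, p l ≤ 1) (hB : 0 ≤ B)
    (hd : ∑ m ∈ s, c m = d)
    (h : ∀ l, v l ^ 2 - B * p l ≤
      (∑ m ∈ s, c m * ((v l ^ 2 + v (l - m) ^ 2) / 2)) - d * v l ^ 2) :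
    ∑' l, v l ^ 2 ≤ B := by
  have hm : ∀ m ∈ s, HasSum (fun l => c m * ((v l ^ 2 + v (l - m) ^ 2) / 2))
      (c m * ∑' l, v l ^ 2) := by
    intro m _
    have h1 : HasSum (fun l => v (l - m) ^ 2) (∑' l, v l ^ 2) :=
      (Equiv.subRight m).hasSum_iff.mpr hv.hasSum
    have h2 := ((hv.hasSum.add h1).div_const 2).mul_left (c m)
    rwa [add_self_div_two] at h2
  have hR := (hasSum_sum hm).sub (hv.hasSum.mul_left d)
  rw [← Finset.sum_mul, hd, sub_self] at hR
  have hle := hasSum_le h (hv.hasSum.sub (hp.hasSum.mul_left B)) hR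
  have := mul_le_mul_of_nonneg_left hp1 hB
  linarith

/-- Exponential decay at every rate `κ ≥ 0` of a square-summable solution of the eigenvalue equation
with hopping range `s`. The bound is useful for `N ≥ 0`. -/
theorem norm_le_exp_of_eigen {E : Type*} [NormedAddCommGroup E] [InnerProductSpace ℂ E]
    {ω ε α κ : ℝ} (hω : 0 < ω) (hα : 0 ≤ α) (hκ : 0 ≤ κ) (s : Finset ℤ) (A : ℤ → E →L[ℂ] E)
    (hA : ∀ m ∈ s, ‖A m‖ ≤ α) (u : ℤ → E)
    (hs : Summable fun l => ‖u l‖ ^ 2) (h1 : ∑' l, ‖u l‖ ^ 2 ≤ 1)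
    (heq : ∀ l : ℤ, (∑ m ∈ s, A m (u (l - m))) - ((l : ℂ) * (ω : ℂ)) • u l = (ε : ℂ) • u l)
    (N : ℤ) :
    ‖u N‖ ≤ Real.exp (-(κ * N)
      + κ / ω * (α * ∑ m ∈ s, max 1 (Real.exp (κ * m)) - ε)) := by
  set S : ℝ := ∑ m ∈ s, max 1 (Real.exp (κ * m)) with hS
  set C : ℝ := κ / ω * (α * S - ε) with hC
  set w : ℤ → ℝ := fun l => Real.exp (κ * (min l N : ℤ)) with hw
  set v : ℤ → ℝ := fun l => w l * ‖u l‖ with hv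
  have hw0 : ∀ l, 0 < w l := fun l => Real.exp_pos _
  have hv0 : ∀ l, 0 ≤ v l := fun l => mul_nonneg (hw0 l).le (norm_nonneg _)
  have hvs : Summable fun l => v l ^ 2 := by
    refine Summable.of_nonneg_of_le (fun l => sq_nonneg _) (fun l => ?_)
      (hs.mul_left (Real.exp (κ * N) ^ 2))
    rw [hv, mul_pow]
    have : w l ≤ Real.exp (κ * N) := by
      simp only [hw]; gcongr; exact min_le_right _ _
    have := (hw0 l).le
    gcongr
  -- The pairing of the eigenvalue equation with `w l ^ 2 • u l`.
  have key : ∀ l : ℤ, ω * (min l N : ℤ) * v l ^ 2 ≤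
      (∑ m ∈ s, α * (max 1 (Real.exp (κ * m)) * ((v l ^ 2 + v (l - m) ^ 2) / 2)))
        - ε * v l ^ 2 := by
    intro l
    have h := mul_le_mul_of_nonneg_left (mul_norm_sq_le hA (heq l)) (sq_nonneg (w l))
    have h2 : ω * (min l N : ℤ) * v l ^ 2 ≤ w l ^ 2 * (ω * l * ‖u l‖ ^ 2) := by
      have : ((min l N : ℤ) : ℝ) ≤ l := by exact_mod_cast min_le_left _ _
      calc ω * (min l N : ℤ) * v l ^ 2 ≤ ω * l * v l ^ 2 := by gcongr
        _ = _ := by simp only [hv]; ring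
    have h3 : w l ^ 2 * ∑ m ∈ s, α * (‖u l‖ * ‖u (l - m)‖) ≤
        ∑ m ∈ s, α * (max 1 (Real.exp (κ * m)) * ((v l ^ 2 + v (l - m) ^ 2) / 2)) := by
      rw [Finset.mul_sum]
      refine Finset.sum_le_sum fun m _ => ?_
      have hc : (0 : ℝ) ≤ max 1 (Real.exp (κ * m)) := le_trans zero_le_one (le_max_left _ _)
      calc w l ^ 2 * (α * (‖u l‖ * ‖u (l - m)‖))
          = α * (v l * (w l * ‖u (l - m)‖)) := by simp only [hv]; ring
        _ ≤ α * (v l * ((max 1 (Real.exp (κ * m)) * w (l - m)) * ‖u (l - m)‖)) := by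
            have := hv0 l
            gcongr
            exact exp_min_le κ hκ N l m
        _ = α * (max 1 (Real.exp (κ * m)) * (v l * v (l - m))) := by
            simp only [hv]; ring
        _ ≤ _ := by
            gcongr
            nlinarith [sq_nonneg (v l - v (l - m))]
    have h4 : w l ^ 2 * (ε * ‖u l‖ ^ 2) = ε * v l ^ 2 := by simp only [hv]; ring
    rw [mul_sub, h4] at h
    linarith
  -- The tangent inequality `exp x - exp a ≤ exp x * (x - a)`, with `exp x = w l ^ 2`, `a = 2 * C`.
  have tangent : ∀ l : ℤ, v l ^ 2 - Real.exp (2 * C) * ‖u l‖ ^ 2 ≤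
      (2 * κ / ω) * ((∑ m ∈ s, α * (max 1 (Real.exp (κ * m)) * ((v l ^ 2 + v (l - m) ^ 2) / 2)))
        - ε * v l ^ 2) - 2 * C * v l ^ 2 := by
    intro l
    have hx : w l ^ 2 = Real.exp (2 * (κ * (min l N : ℤ))) := by
      rw [two_mul, Real.exp_add, ← sq]
    have h := Real.add_one_le_exp (2 * C - 2 * (κ * (min l N : ℤ)))
    have h' := mul_le_mul_of_nonneg_left h (sq_nonneg (w l))
    rw [Real.exp_sub, ← hx, mul_div_cancel₀ _ (pow_pos (hw0 l) 2).ne'] at h'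
    have h'' := mul_le_mul_of_nonneg_right h' (sq_nonneg ‖u l‖)
    have hk := mul_le_mul_of_nonneg_left (key l)
      (div_nonneg (mul_nonneg zero_le_two hκ) hω.le : 0 ≤ 2 * κ / ω)
    have e : 2 * κ / ω * (ω * (min l N : ℤ) * v l ^ 2)
        = 2 * (κ * (min l N : ℤ)) * v l ^ 2 := by
      field_simp
    have e2 : v l ^ 2 = w l ^ 2 * ‖u l‖ ^ 2 := by simp only [hv]; ring
    rw [e] at hk
    refine le_trans ?_ (sub_le_sub_right hk _)
    rw [e2]
    linarith
  have hF : ∑' l, v l ^ 2 ≤ Real.exp (2 * C) := by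
    refine tsum_sq_le_of_convolution_le (s := s)
      (c := fun m => 2 * κ / ω * (α * max 1 (Real.exp (κ * m))))
      (d := 2 * κ / ω * ε + 2 * C) hvs hs h1 (Real.exp_pos _).le ?_ fun l => ?_
    · rw [← Finset.mul_sum, ← Finset.mul_sum, ← hS, hC]
      ring
    · refine (tangent l).trans_eq ?_
      rw [mul_sub, Finset.mul_sum]
      simp only [mul_assoc]
      ring
  have hN : v N ^ 2 ≤ Real.exp C ^ 2 := by
    rw [← Real.exp_nat_mul]
    exact (hvs.le_tsum N fun _ _ => sq_nonneg _).trans (by simpa using hF)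
  have hN' : Real.exp (κ * N) * ‖u N‖ ≤ Real.exp C := by
    have := abs_le_of_sq_le_sq' hN (Real.exp_pos C).le
    simpa [hv, hw] using this.2
  rw [Real.exp_add, Real.exp_neg, inv_mul_eq_div, le_div_iff₀ (Real.exp_pos _), mul_comm]
  exact hN'

/-! ### The numerical constant -/

lemma exp_le_one_add_of_le_half {x : ℝ} (h0 : 0 ≤ x) (h1 : x ≤ 1 / 2) :
    Real.exp x ≤ 1 + 4 / 3 * x := by
  have hhalf : Real.exp (1 / 2) ≤ 5 / 3 := by
    have h : Real.exp (1 / 2) ^ 2 = Real.exp 1 := by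
      rw [← Real.exp_nat_mul]; norm_num
    nlinarith [Real.exp_one_lt_d9, Real.exp_pos (1 / 2)]
  have h := convexOn_exp.2 (Set.mem_univ (0 : ℝ)) (Set.mem_univ (1 / 2 : ℝ))
    (by linarith : 0 ≤ 1 - 2 * x) (by linarith : 0 ≤ 2 * x) (by ring)
  simp only [smul_eq_mul, mul_zero, zero_add, Real.exp_zero, mul_one] at h
  rw [show 2 * x * (1 / 2) = x by ring] at h
  nlinarith

lemma sinh_one_ge : 7 / 6 ≤ Real.sinh 1 := by
  rw [Real.sinh_eq, Real.exp_neg]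
  have h := Real.exp_one_gt_d9
  have : (Real.exp 1)⁻¹ ≤ (2.7 : ℝ)⁻¹ := by gcongr; linarith
  norm_num at this
  linarith

lemma sum_Icc_neg_max_one_exp (κ : ℝ) (hκ : 0 ≤ κ) (M : ℕ) :
    ∑ m ∈ Finset.Icc (-(M : ℤ)) (M : ℤ), max 1 (Real.exp (κ * m)) =
      1 + ∑ k ∈ Finset.range M, (1 + Real.exp (κ * (k + 1))) := by
  induction M with
  | zero => simp
  | succ n ih =>
    have : Finset.Icc (-((n + 1 : ℕ) : ℤ)) ((n + 1 : ℕ) : ℤ)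
        = insert (-((n + 1 : ℕ) : ℤ)) (insert ((n + 1 : ℕ) : ℤ)
          (Finset.Icc (-(n : ℤ)) (n : ℤ))) := by
      ext x; simp only [Finset.mem_Icc, Finset.mem_insert]; omega
    rw [this, Finset.sum_insert, Finset.sum_insert, ih, Finset.sum_range_succ]
    · have hp : 0 ≤ κ * ((n : ℝ) + 1) := by positivity
      push_cast
      rw [max_eq_left, max_eq_right]
      · ring
      · exact Real.one_le_exp hp
      · apply Real.exp_le_one_iff.mpr; linarith
    · simp only [Finset.mem_Icc]; omega
    · simp only [Finset.mem_Icc, Finset.mem_insert]; omega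

/-- The bound `exp x ≤ 1 + 4x/3` on `[0, 1/2]` gives at most
`1 + (2/3) M (M + 1) / (2M + 1)^2 ≤ 7/6`. -/
lemma weight_sum_le_sinh_one (M : ℕ) :
    1 / (2 * (M : ℝ) + 1) * ∑ m ∈ Finset.Icc (-(M : ℤ)) (M : ℤ),
      max 1 (Real.exp (1 / (2 * (M : ℝ) + 1) * m)) ≤ Real.sinh 1 := by
  have hM : (0 : ℝ) ≤ M := Nat.cast_nonneg M
  have hp : (0 : ℝ) < 2 * (M : ℝ) + 1 := by positivity
  refine le_trans ?_ sinh_one_ge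
  rw [sum_Icc_neg_max_one_exp _ (by positivity)]
  have hle : ∑ k ∈ Finset.range M, (1 + Real.exp (1 / (2 * (M : ℝ) + 1) * ((k : ℝ) + 1))) ≤
      ∑ k ∈ Finset.range M, (2 + 4 / 3 * (1 / (2 * (M : ℝ) + 1) * ((k : ℝ) + 1))) := by
    refine Finset.sum_le_sum fun k hk => ?_
    have hk' : (k : ℝ) + 1 ≤ M := by exact_mod_cast Finset.mem_range.mp hk
    have := exp_le_one_add_of_le_half (x := 1 / (2 * (M : ℝ) + 1) * ((k : ℝ) + 1))
      (by positivity) (by rw [one_div_mul_eq_div, div_le_iff₀ hp]; linarith)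
    linarith
  have hsum : ∀ n : ℕ, ∑ k ∈ Finset.range n, ((k : ℝ) + 1) = n * (n + 1) / 2 := by
    intro n
    induction n with
    | zero => simp
    | succ n ih => rw [Finset.sum_range_succ, ih]; push_cast; ring
  rw [Finset.sum_add_distrib (f := fun _ => (2 : ℝ)), ← Finset.mul_sum, ← Finset.mul_sum, hsum]
    at hle
  simp only [Finset.sum_const, Finset.card_range, nsmul_eq_mul] at hle
  rw [one_div_mul_eq_div, div_le_iff₀ hp]
  have : 4 / 3 * (1 / (2 * (M : ℝ) + 1) * ((M : ℝ) * (M + 1) / 2)) ≤ (2 * (M : ℝ) + 1) / 6 := by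
    rw [one_div_mul_eq_div, ← mul_div_assoc, div_le_iff₀ hp]
    nlinarith
  linarith

/-! ### Both signs of the frequency index -/

/-- The decay bound for any solution of the eigenvalue equation of the Floquet Hamiltonian with total
weight at most `1`. -/
theorem norm_le_of_floquetHamiltonian_eq {E : Type*} [NormedAddCommGroup E]
    [InnerProductSpace ℂ E] {T : ℝ} (hT : 0 < T) {M : ℕ} {α : ℝ} {H : ℤ → E →L[ℂ] E}
    (hH : ∀ m ∈ Finset.Icc (-(M : ℤ)) (M : ℤ), ‖H m‖ ≤ α) {ε : ℝ} (hε : ε ∈ brillouinZone T)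
    {u : ℤ → E} (hs : Summable fun l => ‖u l‖ ^ 2) (h1 : ∑' l, ‖u l‖ ^ 2 ≤ 1)
    (heq : ∀ l : ℤ, floquetHamiltonian T M H u l = (ε : ℂ) • u l) (l : ℤ) :
    ‖u l‖ ≤ Real.exp (-((|(l : ℝ)| - 1 / 2) / (2 * (M : ℝ) + 1))
      + Real.sinh 1 / (2 * Real.pi) * (α * T)) := by
  have hω : 0 < freq T := div_pos Real.two_pi_pos hT
  have hα : 0 ≤ α := (norm_nonneg _).trans (hH 0 (by simp))
  obtain ⟨hε1, hε2⟩ := hε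
  have hκ : 0 ≤ 1 / (2 * (M : ℝ) + 1) := by positivity
  have hS := weight_sum_le_sinh_one M
  set κ : ℝ := 1 / (2 * (M : ℝ) + 1) with hκdef
  set S : ℝ := ∑ m ∈ Finset.Icc (-(M : ℤ)) (M : ℤ), max 1 (Real.exp (κ * m))
  have bound : ∀ δ : ℝ, -(freq T) / 2 ≤ δ → κ / freq T * (α * S - δ) ≤
      κ / 2 + Real.sinh 1 / (2 * Real.pi) * (α * T) := by
    intro δ hδ
    have h1 : κ / freq T * (α * S - δ) = κ * S * (α / freq T) + κ * (-δ / freq T) := by ring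
    have h2 : -δ / freq T ≤ 1 / 2 := by rw [div_le_iff₀ hω]; linarith
    have h3 : α / freq T = α * T / (2 * Real.pi) := by rw [freq, div_div_eq_mul_div]
    have h4 : κ * S * (α / freq T) ≤ Real.sinh 1 * (α / freq T) := by gcongr
    rw [h1]
    have h5 : Real.sinh 1 / (2 * Real.pi) * (α * T) = Real.sinh 1 * (α / freq T) := by
      rw [h3]; ring
    rw [h5]
    nlinarith
  have hgoal : -((|(l : ℝ)| - 1 / 2) / (2 * (M : ℝ) + 1))
      + Real.sinh 1 / (2 * Real.pi) * (α * T) =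
      -(κ * |(l : ℝ)|) + (κ / 2 + Real.sinh 1 / (2 * Real.pi) * (α * T)) := by
    rw [hκdef]; ring
  rw [hgoal]
  rcases le_total 0 l with hl | hl
  · have h := norm_le_exp_of_eigen hω hα hκ _ H hH u hs h1 heq l
    refine h.trans (Real.exp_le_exp.mpr ?_)
    rw [abs_of_nonneg (by exact_mod_cast hl)]
    exact add_le_add_right (bound ε hε1) _
  · -- The reflected family solves the equation for `m ↦ -H (-m)` with quasienergy `-ε`.
    have heq' : ∀ k : ℤ, (∑ m ∈ Finset.Icc (-(M : ℤ)) (M : ℤ), (-H (-m)) (u (-(k - m))))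
        - ((k : ℂ) * (freq T : ℂ)) • u (-k) = ((-ε : ℝ) : ℂ) • u (-k) := by
      intro k
      have h := heq (-k)
      rw [floquetHamiltonian] at h
      have hr : ∑ m ∈ Finset.Icc (-(M : ℤ)) (M : ℤ), (-H (-m)) (u (-(k - m)))
          = -∑ m ∈ Finset.Icc (-(M : ℤ)) (M : ℤ), H m (u (-k - m)) := by
        rw [← Finset.sum_neg_distrib]
        refine Finset.sum_nbij' (fun m => -m) (fun m => -m) ?_ ?_ ?_ ?_ ?_
        · intro m hm; simp only [Finset.mem_Icc] at hm ⊢; omega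
        · intro m hm; simp only [Finset.mem_Icc] at hm ⊢; omega
        · intro m _; simp
        · intro m _; simp
        · intro m _
          rw [_root_.neg_apply, show -(k - m) = -k - -m by ring]
      rw [hr]
      push_cast at h ⊢
      rw [neg_smul, ← h, neg_mul, neg_smul]
      abel
    have h := norm_le_exp_of_eigen hω hα hκ _ (fun m => -H (-m))
      (fun m hm => by
        rw [norm_neg]
        exact hH _ (by simp only [Finset.mem_Icc] at hm ⊢; omega))
      (fun k => u (-k)) ((Equiv.neg ℤ).summable_iff.mpr hs)
      (((Equiv.neg ℤ).tsum_eq fun l => ‖u l‖ ^ 2).trans_le h1) heq' (-l)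
    simp only [neg_neg] at h
    refine h.trans (Real.exp_le_exp.mpr ?_)
    rw [abs_of_nonpos (by exact_mod_cast hl), Int.cast_neg]
    exact add_le_add_right (bound (-ε) (by linarith)) _

/-! ### Fourier components of a Floquet eigenstate -/

lemma periodic_exp_freq {T : ℝ} (hT : T ≠ 0) (l : ℤ) :
    Function.Periodic (fun t : ℝ => Complex.exp (Complex.I * l * freq T * t)) T := by
  intro t
  rw [Complex.exp_eq_exp_iff_exists_int]
  refine ⟨l, ?_⟩
  have : (freq T : ℂ) * T = 2 * Real.pi := by
    rw [freq]; push_cast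
    rw [div_mul_cancel₀]; exact_mod_cast hT
  push_cast
  linear_combination (Complex.I * l) * this

lemma hasDerivAt_exp_freq (T : ℝ) (l : ℤ) (t : ℝ) :
    HasDerivAt (fun t : ℝ => Complex.exp (Complex.I * l * freq T * t))
      (Complex.exp (Complex.I * l * freq T * t) * (Complex.I * l * freq T)) t := by
  have h := ((Complex.ofRealCLM.hasDerivAt (x := t)).const_mul
    (Complex.I * l * freq T : ℂ)).cexp
  simpa using h

lemma integral_exp_freq {T : ℝ} (hT : 0 < T) (l : ℤ) :
    ∫ t in (0 : ℝ)..T, Complex.exp (Complex.I * l * freq T * t) = if l = 0 then (T : ℂ) else 0 := by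
  split_ifs with h
  · simp [h]
  · have hc : (Complex.I * l * freq T : ℂ) ≠ 0 := by
      have : freq T ≠ 0 := (div_pos Real.two_pi_pos hT).ne'
      simp [h, this]
    rw [integral_exp_mul_complex hc]
    have := periodic_exp_freq hT.ne' l 0
    simp only [zero_add] at this
    rw [this, sub_self, zero_div]

section

variable {E : Type*} [NormedAddCommGroup E] [InnerProductSpace ℂ E]

lemma continuous_exp_freq_smul (T : ℝ) (l : ℤ) {f : ℝ → E} (hf : Continuous f) :
    Continuous fun t : ℝ => Complex.exp (Complex.I * l * freq T * t) • f t := by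
  fun_prop

lemma integral_eq_smul_fourierComponent {T : ℝ} (hT : T ≠ 0) (φ : ℝ → E) (l : ℤ) :
    ∫ t in (0 : ℝ)..T, Complex.exp (Complex.I * l * freq T * t) • φ t
      = (T : ℂ) • fourierComponent T φ l := by
  have : (T : ℂ) ≠ 0 := by exact_mod_cast hT
  rw [fourierComponent, smul_smul, mul_one_div_cancel this, one_smul]

/-- The trigonometric polynomial `∑_{k ∈ s} e^{-ikωt} c_k`. -/
noncomputable def trigPoly (T : ℝ) (s : Finset ℤ) (c : ℤ → E) (t : ℝ) : E :=
  ∑ k ∈ s, Complex.exp (Complex.I * ((-k : ℤ) : ℂ) * freq T * t) • c k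

lemma continuous_trigPoly (T : ℝ) (s : Finset ℤ) (c : ℤ → E) : Continuous (trigPoly T s c) :=
  continuous_finsetSum _ fun k _ => continuous_exp_freq_smul T (-k) continuous_const

lemma conj_exp_freq (T : ℝ) (k : ℤ) (t : ℝ) :
    (starRingEnd ℂ) (Complex.exp (Complex.I * ((-k : ℤ) : ℂ) * freq T * t))
      = Complex.exp (Complex.I * k * freq T * t) := by
  rw [← Complex.exp_conj]
  simp

lemma integral_inner_trigPoly [CompleteSpace E] {T : ℝ} (hT : T ≠ 0) (s : Finset ℤ) (c : ℤ → E)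
    {f : ℝ → E} (hf : Continuous f) :
    ∫ t in (0 : ℝ)..T, inner ℂ (trigPoly T s c t) (f t)
      = T * ∑ k ∈ s, inner ℂ (c k) (fourierComponent T f k) := by
  simp only [trigPoly, sum_inner, inner_smul_left, conj_exp_freq]
  rw [intervalIntegral.integral_finsetSum]
  · rw [Finset.mul_sum]
    refine Finset.sum_congr rfl fun k _ => ?_
    rw [← inner_smul_right, ← integral_eq_smul_fourierComponent hT]
    have := (innerSL ℂ (c k)).intervalIntegral_comp_comm
      ((continuous_exp_freq_smul T k hf).intervalIntegrable (μ := MeasureTheory.volume) 0 T)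
    simp only [innerSL_apply_apply, inner_smul_right] at this
    exact this
  · intro k _
    exact ((continuous_exp_freq_smul T k
      (continuous_const.inner hf)).intervalIntegrable 0 T)

lemma fourierComponent_trigPoly [CompleteSpace E] {T : ℝ} (hT : 0 < T) (s : Finset ℤ) (c : ℤ → E)
    {l : ℤ} (hl : l ∈ s) : fourierComponent T (trigPoly T s c) l = c l := by
  have hT' : (T : ℂ) ≠ 0 := by exact_mod_cast hT.ne'
  have e : ∀ t : ℝ, Complex.exp (Complex.I * l * freq T * t) • trigPoly T s c t
      = ∑ k ∈ s, Complex.exp (Complex.I * ((l - k : ℤ) : ℂ) * freq T * t) • c k := by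
    intro t
    rw [trigPoly, Finset.smul_sum]
    refine Finset.sum_congr rfl fun k _ => ?_
    rw [smul_smul, ← Complex.exp_add]
    congr 2
    push_cast
    ring
  rw [fourierComponent]
  simp only [e]
  rw [intervalIntegral.integral_finsetSum]
  · simp only [intervalIntegral.integral_smul_const, integral_exp_freq hT, sub_eq_zero,
      ite_smul, zero_smul]
    rw [Finset.sum_ite_eq s l, if_pos hl, smul_smul, one_div_mul_cancel hT', one_smul]
  · intro k _
    exact (continuous_exp_freq_smul T (l - k) continuous_const).intervalIntegrable 0 T

/-- Bessel's inequality for a vector-valued function of constant norm `1`. -/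
lemma sum_norm_sq_fourierComponent_le_one [CompleteSpace E] {T : ℝ} (hT : 0 < T) {φ : ℝ → E}
    (hφ : Continuous φ) (h1 : ∀ t, ‖φ t‖ = 1) (s : Finset ℤ) :
    ∑ l ∈ s, ‖fourierComponent T φ l‖ ^ 2 ≤ 1 := by
  -- Integrate `2 Re ⟪g, φ⟫ - ‖g‖ ^ 2 ≤ ‖φ‖ ^ 2` over a period, `g` the partial Fourier sum of `φ`.
  set g := trigPoly T s (fourierComponent T φ) with hg
  have hgc : Continuous g := continuous_trigPoly _ _ _
  have hval : ∀ f : ℝ → E, Continuous f →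
      (∀ l ∈ s, fourierComponent T f l = fourierComponent T φ l) →
      ∫ t in (0 : ℝ)..T, (inner ℂ (g t) (f t)).re
        = T * ∑ l ∈ s, ‖fourierComponent T φ l‖ ^ 2 := by
    intro f hf hl
    have h := Complex.reCLM.intervalIntegral_comp_comm
      ((hgc.inner hf : Continuous fun t => inner ℂ (g t) (f t)).intervalIntegrable
        (μ := MeasureTheory.volume) 0 T)
    simp only [Complex.reCLM_apply] at h
    rw [h, hg, integral_inner_trigPoly hT.ne' s _ hf, Complex.re_ofReal_mul, Complex.re_sum]
    congr 1
    refine Finset.sum_congr rfl fun l hls => ?_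
    rw [hl l hls, inner_self_eq_norm_sq_to_K]
    norm_cast
  have i1 := hval φ hφ fun _ _ => rfl
  have i2 := hval g hgc fun l hl => fourierComponent_trigPoly hT s _ hl
  have c1 : Continuous fun t => (inner ℂ (g t) (φ t)).re :=
    Complex.continuous_re.comp (hgc.inner hφ)
  have c2 : Continuous fun t => (inner ℂ (g t) (g t)).re :=
    Complex.continuous_re.comp (hgc.inner hgc)
  have c3 : Continuous fun t => 2 * (inner ℂ (g t) (φ t)).re := continuous_const.mul c1
  have hle : ∫ t in (0 : ℝ)..T, (2 * (inner ℂ (g t) (φ t)).re - (inner ℂ (g t) (g t)).re)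
      ≤ ∫ _t in (0 : ℝ)..T, (1 : ℝ) := by
    refine intervalIntegral.integral_mono_on hT.le
      ((c3.sub c2).intervalIntegrable 0 T)
      (continuous_const.intervalIntegrable 0 T) fun t _ => ?_
    have h : (inner ℂ (g t) (g t)).re = ‖g t‖ ^ 2 := by
      rw [inner_self_eq_norm_sq_to_K]; norm_cast
    have h' : (inner ℂ (g t) (φ t)).re ≤ ‖g t‖ * ‖φ t‖ := re_inner_le_norm (𝕜 := ℂ) _ _
    rw [h1, mul_one] at h'
    nlinarith [sq_nonneg (‖g t‖ - 1)]
  rw [intervalIntegral.integral_sub (c3.intervalIntegrable 0 T)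
    (c2.intervalIntegrable 0 T), intervalIntegral.integral_const_mul, i1, i2] at hle
  simp only [intervalIntegral.integral_const, sub_zero, smul_eq_mul, mul_one] at hle
  have : T * ∑ l ∈ s, ‖fourierComponent T φ l‖ ^ 2 ≤ T * 1 := by linarith
  exact le_of_mul_le_mul_left this hT

/-- The Schrödinger equation for `e^{-iεt} φ(t)`, rewritten for the periodic part `φ`. -/
lemma IsFloquetEigenstate.hasDerivAt {T : ℝ} {M : ℕ} {H : ℤ → E →L[ℂ] E} {ε : ℝ} {φ : ℝ → E}
    (h : IsFloquetEigenstate T M H ε φ) (t : ℝ) :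
    HasDerivAt φ ((Complex.I * ε) • φ t - Complex.I • hamiltonian T M H t (φ t)) t := by
  have he : HasDerivAt (fun s : ℝ => Complex.exp (Complex.I * ε * s))
      (Complex.exp (Complex.I * ε * t) * (Complex.I * ε)) t := by
    have h := ((Complex.ofRealCLM.hasDerivAt (x := t)).const_mul (Complex.I * ε : ℂ)).cexp
    simpa using h
  have hp := he.smul (h.schrodinger t)
  have hc : ∀ s : ℝ, Complex.exp (Complex.I * ε * s) * Complex.exp (-(Complex.I * ε * s)) = 1 :=
    fun s => by rw [← Complex.exp_add, add_neg_cancel, Complex.exp_zero]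
  have hf : ((fun s : ℝ => Complex.exp (Complex.I * ε * s)) •
      fun s : ℝ => Complex.exp (-(Complex.I * ε * s)) • φ s) = φ := by
    funext s
    simp only [Pi.smul_apply', smul_smul, hc, one_smul]
  rw [hf] at hp
  convert hp using 1
  rw [map_smul]
  simp only [smul_smul]
  rw [show Complex.exp (Complex.I * ε * t) * (-Complex.I * Complex.exp (-(Complex.I * ε * t)))
      = -Complex.I by linear_combination (-Complex.I) * hc t,
    show Complex.exp (Complex.I * ε * t) * (Complex.I * ε) * Complex.exp (-(Complex.I * ε * t))
      = Complex.I * ε by linear_combination (Complex.I * ε) * hc t, neg_smul]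
  abel

lemma IsFloquetEigenstate.continuous {T : ℝ} {M : ℕ} {H : ℤ → E →L[ℂ] E} {ε : ℝ} {φ : ℝ → E}
    (h : IsFloquetEigenstate T M H ε φ) : Continuous φ :=
  continuous_iff_continuousAt.mpr fun t => (h.hasDerivAt t).continuousAt

lemma integral_exp_freq_smul_hamiltonian [CompleteSpace E] {T : ℝ} (hT : T ≠ 0) (M : ℕ)
    (H : ℤ → E →L[ℂ] E) {φ : ℝ → E} (hφ : Continuous φ) (l : ℤ) :
    ∫ t in (0 : ℝ)..T, Complex.exp (Complex.I * l * freq T * t) • hamiltonian T M H t (φ t)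
      = (T : ℂ) • ∑ m ∈ Finset.Icc (-(M : ℤ)) (M : ℤ), H m (fourierComponent T φ (l - m)) := by
  have e : ∀ t : ℝ, Complex.exp (Complex.I * l * freq T * t) • hamiltonian T M H t (φ t)
      = ∑ m ∈ Finset.Icc (-(M : ℤ)) (M : ℤ),
        H m (Complex.exp (Complex.I * ((l - m : ℤ) : ℂ) * freq T * t) • φ t) := by
    intro t
    rw [hamiltonian, _root_.sum_apply, Finset.smul_sum]
    refine Finset.sum_congr rfl fun m _ => ?_
    rw [_root_.smul_apply, smul_smul, ← Complex.exp_add, map_smul]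
    congr 2
    push_cast
    ring
  simp only [e]
  rw [intervalIntegral.integral_finsetSum, Finset.smul_sum]
  · refine Finset.sum_congr rfl fun m _ => ?_
    rw [(H m).intervalIntegral_comp_comm
      ((continuous_exp_freq_smul T (l - m) hφ).intervalIntegrable 0 T),
      integral_eq_smul_fourierComponent hT, map_smul]
  · intro m _
    exact ((H m).continuous.comp (continuous_exp_freq_smul T (l - m) hφ)).intervalIntegrable 0 T

/-- The Fourier components of a Floquet eigenstate solve the eigenvalue equation of the Floquet
Hamiltonian: `e^{ilωt} φ(t)` is periodic, so its derivative integrates to zero over a period. -/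
theorem IsFloquetEigenstate.floquetHamiltonian_fourierComponent [CompleteSpace E] {T : ℝ}
    (hT : T ≠ 0) {M : ℕ} {H : ℤ → E →L[ℂ] E} {ε : ℝ} {φ : ℝ → E}
    (h : IsFloquetEigenstate T M H ε φ) (l : ℤ) :
    floquetHamiltonian T M H (fourierComponent T φ) l = (ε : ℂ) • fourierComponent T φ l := by
  have hT' : (T : ℂ) ≠ 0 := by exact_mod_cast hT
  have hφ := h.continuous
  have hham : Continuous fun t => hamiltonian T M H t (φ t) := by
    simp only [hamiltonian, _root_.sum_apply, _root_.smul_apply]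
    fun_prop
  have c1 : Continuous fun t : ℝ => (Complex.I * (l * freq T + ε)) •
      (Complex.exp (Complex.I * l * freq T * t) • φ t) :=
    (continuous_exp_freq_smul T l hφ).const_smul _
  have c2 : Continuous fun t : ℝ => Complex.I •
      (Complex.exp (Complex.I * l * freq T * t) • hamiltonian T M H t (φ t)) :=
    (continuous_exp_freq_smul T l hham).const_smul _
  have hd : ∀ t : ℝ, HasDerivAt (fun t : ℝ => Complex.exp (Complex.I * l * freq T * t) • φ t)
      ((Complex.I * (l * freq T + ε)) • (Complex.exp (Complex.I * l * freq T * t) • φ t)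
        - Complex.I • (Complex.exp (Complex.I * l * freq T * t) • hamiltonian T M H t (φ t)))
      t := by
    intro t
    refine ((hasDerivAt_exp_freq T l t).smul (h.hasDerivAt t)).congr_deriv ?_
    module
  have hint := intervalIntegral.integral_eq_sub_of_hasDerivAt (a := 0) (b := T)
    (fun t _ => hd t) ((c1.sub c2).intervalIntegrable 0 T)
  have hper := periodic_exp_freq hT l 0
  have hper' := h.periodic 0
  simp only [zero_add] at hper hper'
  rw [hper, hper', sub_self, intervalIntegral.integral_sub
    (c1.intervalIntegrable 0 T) (c2.intervalIntegrable 0 T),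
    intervalIntegral.integral_smul, intervalIntegral.integral_smul,
    integral_eq_smul_fourierComponent hT, integral_exp_freq_smul_hamiltonian hT M H hφ] at hint
  rw [floquetHamiltonian]
  set Q := ∑ m ∈ Finset.Icc (-(M : ℤ)) (M : ℤ), H m (fourierComponent T φ (l - m))
  have hz : (Complex.I * T) • (((l : ℂ) * freq T + ε) • fourierComponent T φ l - Q) = 0 := by
    rw [← hint]
    module
  rw [smul_eq_zero_iff_right (mul_ne_zero Complex.I_ne_zero hT'), sub_eq_zero] at hz
  rw [← hz]
  module

end

end Floquet

theorem theorem2 {E : Type*} [NormedAddCommGroup E] [InnerProductSpace ℂ E]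
    [FiniteDimensional ℂ E] (T : ℝ) (hT : 0 < T) (M : ℕ) (α : ℝ) (H : ℤ → E →L[ℂ] E)
    (hH : Floquet.IsBoundedHamiltonian T M α H) (ε : ℝ) (hε : ε ∈ Floquet.brillouinZone T) :
    (∀ φ : ℝ → E, Floquet.IsFloquetEigenstate T M H ε φ → ∀ l : ℤ,
      ‖Floquet.fourierComponent T φ l‖ ≤
        Real.exp (-((|(l : ℝ)| - 1 / 2) / (2 * (M : ℝ) + 1))
          + Real.sinh 1 / (2 * Real.pi) * (α * T))) ∧
    (∀ Φ : Floquet.SambeSpace E, Floquet.IsSambeEigenstate T M H ε Φ → ∀ l : ℤ,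
      ‖Φ l‖ ≤
        Real.exp (-((|(l : ℝ)| - 1 / 2) / (2 * (M : ℝ) + 1))
          + Real.sinh 1 / (2 * Real.pi) * (α * T))) := by
  have : CompleteSpace E := FiniteDimensional.complete ℂ E
  refine ⟨fun φ hφ l => ?_, fun Φ hΦ l => ?_⟩
  · have hB := Floquet.sum_norm_sq_fourierComponent_le_one hT hφ.continuous hφ.norm_eq_one
    exact Floquet.norm_le_of_floquetHamiltonian_eq hT hH.norm_le hε
      (summable_of_sum_le (fun _ => sq_nonneg _) hB)
      (Real.tsum_le_of_sum_le (fun _ => sq_nonneg _) hB)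
      (hφ.floquetHamiltonian_fourierComponent hT.ne') l
  · have hsum : HasSum (fun l => ‖Φ l‖ ^ 2) 1 := by
      have h := lp.hasSum_norm (p := 2) (by norm_num) Φ
      simpa [hΦ.norm_eq_one] using h
    exact Floquet.norm_le_of_floquetHamiltonian_eq hT hH.norm_le hε hsum.summable
      hsum.tsum_eq.le hΦ.eigen l
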